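/- Let $A$ be a nonnegative $n\times n$ matrix, considered either in nonnegative algebra (operations $+,\cdot$ on $\mathbb{R}_+$) or in max algebra (operations $\max,\cdot$ on $\mathbb{R}_+$). Matrix powers $A^k$, products $Ax$ and all notions below are taken in the chosen algebra; the statement holds in each of the two. For $\rho\ge 0$ let $V(A,\rho)=\{x\in\mathbb{R}_+^n : Ax=\rho x\}$; $\rho$ is an eigenvalue of $A$ if $V(A,\rho)\neq\{0\}$, and $\Lambda(A)$ is the set of nonzero eigenvalues. A class $\mu$ of $A$ is a strongly connected component of the digraph with edges $\{(i,j): a_{ij}>0\}$ (a single node without a loop may form a class); its Perron root $\rho_\mu$ is the greatest eigenvalue of the principal submatrix of $A$ on the nodes of $\mu$. Write $\mu\to\nu$ ($\mu$ accesses $\nu$) if $\mu=\nu$ or there is a path from $\mu$ to $\nu$ in the reduced graph, whose nodes are the classes and whose arcs are the pairs $(\mu,\nu)$ with $a_{kl}>0$ for some $k\in\mu$, $l\in\nu$. An index $i$ accesses $\nu$ if the class containing $i$ does. For $\rho\neq0$, a class $\nu$ is $(A,\rho)$-spectral if $\rho_\nu=\rho$ and - in max algebra: $\mu\to\nu$ implies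 $\rho_\mu\le\rho_\nu$; - in nonnegative algebra: $\mu\to\nu$ and $\mu\ne\nu$ imply $\rho_\mu<\rho_\nu$. For $\rho\in\Lambda(A)$ let $M_\rho$ be the set of indices that access some $(A,\rho)$-spectral class, and let $A_\rho$ be the $n\times n$ matrix with entries $\rho^{-1}a_{ij}$ if $i,j\in M_\rho$ and $0$ otherwise. **Theorem.** Let $\rho\in\Lambda(A)$ and $k\ge1$. Then: 1. the set of all indices that access some $(A^k,\rho^k)$-spectral class equals $M_\rho$; 2. $(A^k)_{M_\rho M_\rho}=\rho^k\,\bigl((A_\rho)^k\bigr)_{M_\rho M_\rho}$; 3. $V(A^k,\rho^k)=V((A_\rho)^k,1)$, and $1$ is the principal (that is, greatest) eigenvalue of $(A_\rho)^k$. -/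

import Mathlib

open scoped NNReal

noncomputable section

/-- The two algebras over the nonnegative reals: the usual nonnegative algebra `(+, ·)` and
max algebra `(max, ·)`. -/
inductive Alg : Type
  | nonneg
  | max

namespace Alg

variable {ι : Type*}

/-- Finite sum in the algebra: `∑` in nonnegative algebra, maximum in max algebra. -/
def sum (K : Alg) (s : Finset ι) (f : ι → ℝ≥0) : ℝ≥0 :=
  match K with
  | nonneg => ∑ i ∈ s, f i
  | max => s.sup f

variable [Fintype ι]

/-- Matrix product in the algebra. -/
def mul (K : Alg) (A B : Matrix ι ι ℝ≥0) : Matrix ι ι ℝ≥0 :=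
  Matrix.of fun i j => K.sum Finset.univ fun l => A i l * B l j

/-- Matrix-vector product in the algebra. -/
def mulVec (K : Alg) (A : Matrix ι ι ℝ≥0) (x : ι → ℝ≥0) : ι → ℝ≥0 :=
  fun i => K.sum Finset.univ fun j => A i j * x j

/-- Matrix power in the algebra. -/
def pow [DecidableEq ι] (K : Alg) (A : Matrix ι ι ℝ≥0) : ℕ → Matrix ι ι ℝ≥0
  | 0 => 1
  | k + 1 => K.mul (K.pow A k) A

theorem mulVec_nonneg (A : Matrix ι ι ℝ≥0) (x : ι → ℝ≥0) :
    nonneg.mulVec A x = Matrix.mulVec A x := rfl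

theorem pow_nonneg [DecidableEq ι] (A : Matrix ι ι ℝ≥0) (k : ℕ) : nonneg.pow A k = A ^ k := by
  induction k with
  | zero => simp [pow]
  | succ k ih => rw [pow, ih, pow_succ]; rfl

/-- The eigencone `V(A, ρ)`: the nonnegative eigenvectors for `ρ`, and the zero vector. -/
def eigencone (K : Alg) (A : Matrix ι ι ℝ≥0) (ρ : ℝ≥0) : Set (ι → ℝ≥0) :=
  {x | K.mulVec A x = ρ • x}

/-- `ρ` is an eigenvalue of `A`: it has a nonzero nonnegative eigenvector. -/
def IsEigenvalue (K : Alg) (A : Matrix ι ι ℝ≥0) (ρ : ℝ≥0) : Prop :=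
  ∃ x : ι → ℝ≥0, x ≠ 0 ∧ K.mulVec A x = ρ • x

/-- `Λ(A)`: the set of nonzero eigenvalues. -/
def nonzeroSpectrum (K : Alg) (A : Matrix ι ι ℝ≥0) : Set ℝ≥0 :=
  {ρ | ρ ≠ 0 ∧ K.IsEigenvalue A ρ}

/-- The principal eigenvalue: the greatest eigenvalue. -/
def principalEigenvalue (K : Alg) (A : Matrix ι ι ℝ≥0) : ℝ≥0 :=
  sSup {ρ | K.IsEigenvalue A ρ}

end Alg

section Classes

variable {ι : Type*}

/-- There is a path (possibly of length zero) from `i` to `j` in the digraph of `A`, whose edges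
are the pairs `(i, j)` with `A i j ≠ 0`. -/
def HasPath (A : Matrix ι ι ℝ≥0) : ι → ι → Prop :=
  Relation.ReflTransGen fun i j => A i j ≠ 0

/-- `N` is the node set of a strongly connected component of the digraph of `A`. -/
def IsClass (A : Matrix ι ι ℝ≥0) (N : Finset ι) : Prop :=
  ∃ i, ∀ j, j ∈ N ↔ HasPath A i j ∧ HasPath A j i

/-- The classes of `A`, that is, the nodes of the reduced graph, given by their node sets. -/
def MatrixClass (A : Matrix ι ι ℝ≥0) : Type _ :=
  {N : Finset ι // IsClass A N}

namespace MatrixClass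

variable {A : Matrix ι ι ℝ≥0}

/-- The node set of a class. -/
def nodes (μ : MatrixClass A) : Finset ι := μ.1

/-- The arcs of the reduced graph. -/
def Arc (μ ν : MatrixClass A) : Prop :=
  ∃ k ∈ μ.nodes, ∃ l ∈ ν.nodes, 0 < A k l

/-- `μ → ν`: the classes are equal or there is a path from `μ` to `ν` in the reduced graph. -/
def Accesses (μ ν : MatrixClass A) : Prop :=
  Relation.ReflTransGen Arc μ ν

/-- `i → ν`: the node `i` lies in a class that accesses `ν`. -/
def NodeAccesses (i : ι) (ν : MatrixClass A) : Prop :=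
  ∃ μ : MatrixClass A, i ∈ μ.nodes ∧ μ.Accesses ν

/-- The Perron root of a class `μ`: the principal eigenvalue of the diagonal block of `μ`. -/
def perronRoot (K : Alg) (μ : MatrixClass A) : ℝ≥0 :=
  K.principalEigenvalue
    (A.submatrix (Subtype.val : μ.nodes → ι) (Subtype.val : μ.nodes → ι))

/-- `ν` is an `(A, ρ)`-spectral class. -/
def IsSpectral (K : Alg) (ν : MatrixClass A) (ρ : ℝ≥0) : Prop :=
  ρ ≠ 0 ∧ ν.perronRoot K = ρ ∧
    match K with
    | Alg.max => ∀ μ : MatrixClass A, μ.Accesses ν →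
        μ.perronRoot Alg.max ≤ ν.perronRoot Alg.max
    | Alg.nonneg => ∀ μ : MatrixClass A, μ.Accesses ν → μ ≠ ν →
        μ.perronRoot Alg.nonneg < ν.perronRoot Alg.nonneg

end MatrixClass

/-- `M_ρ`: the set of indices that access some `(A, ρ)`-spectral class. -/
def spectralAccessSet (K : Alg) (A : Matrix ι ι ℝ≥0) (ρ : ℝ≥0) : Set ι :=
  {i | ∃ ν : MatrixClass A, ν.IsSpectral K ρ ∧ MatrixClass.NodeAccesses i ν}

open Classical in
/-- `A_ρ`: the matrix `ρ⁻¹ A` with all entries outside the block `M_ρ × M_ρ` replaced by zero. -/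
def reducedMatrix (K : Alg) (A : Matrix ι ι ℝ≥0) (ρ : ℝ≥0) : Matrix ι ι ℝ≥0 :=
  Matrix.of fun i j =>
    if i ∈ spectralAccessSet K A ρ ∧ j ∈ spectralAccessSet K A ρ then ρ⁻¹ * A i j else 0

end Classes

/-- The principal submatrix `A_{MM}`. -/
def principalSubmatrix {ι : Type*} (A : Matrix ι ι ℝ≥0) (M : Set ι) : Matrix M M ℝ≥0 :=
  A.submatrix Subtype.val Subtype.val

end

/-! The key fact is that $M_\rho$ is the union of the supports of the vectors in $V(A,\rho)$
(`mem_spectralAccessSet_iff`). An eigenvector of $A$ is one of $A^k$, and an eigenvector of $A^k$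
lies below one of $A$, namely the sum of its orbit under $\rho^{-1}A$
(`Alg.exists_eigenvector_of_pow`); so the sets for $A$ and $A^k$ agree. Since $M_\rho$ contains all
predecessors of its nodes, cutting $A$ down to $M_\rho$ loses no path ending there. This gives the
block identity, and the equality of eigencones because both sides are supported in $M_\rho$. An
eigenvector with support exactly $M_\rho$ then bounds every eigenvalue of $(A_\rho)^k$ by 1
(`Alg.eigenvalue_le`).

For the key fact, a final class within the support of an eigenvector is spectral. Conversely, a
spectral class yields a sub-eigenvector below a super-eigenvector, and a monotone fixed point lies
between them (`MatrixClass.IsSpectral.exists_eigenvector`). Both directions rest on Perron–Frobenius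
theory for the irreducible diagonal blocks. -/

open scoped NNReal

noncomputable section

/-! ### Arithmetic common to the two algebras -/

namespace Alg

variable {ι κ : Type*}

/-- Addition in the algebra. -/
def add (K : Alg) (a b : ℝ≥0) : ℝ≥0 :=
  match K with
  | nonneg => a + b
  | max => Max.max a b

theorem add_mono (K : Alg) {a b c d : ℝ≥0} (h : a ≤ c) (h' : b ≤ d) :
    K.add a b ≤ K.add c d := by
  cases K
  · exact add_le_add h h'
  · exact max_le_max h h'

theorem add_zero (K : Alg) (a : ℝ≥0) : K.add a 0 = a := by
  cases K <;> simp [add]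

theorem add_comm (K : Alg) (a b : ℝ≥0) : K.add a b = K.add b a := by
  cases K
  · exact _root_.add_comm a b
  · exact max_comm a b

theorem add_mul (K : Alg) (a b c : ℝ≥0) : K.add a b * c = K.add (a * c) (b * c) := by
  cases K
  · exact _root_.add_mul a b c
  · exact max_mul_of_nonneg a b c.2

theorem add_assoc (K : Alg) (a b c : ℝ≥0) : K.add (K.add a b) c = K.add a (K.add b c) := by
  cases K
  · exact _root_.add_assoc a b c
  · exact max_assoc a b c

theorem sum_empty (K : Alg) (f : ι → ℝ≥0) : K.sum ∅ f = 0 := by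
  cases K <;> simp [sum]

theorem sum_insert [DecidableEq ι] (K : Alg) {s : Finset ι} {a : ι} (ha : a ∉ s) (f : ι → ℝ≥0) :
    K.sum (insert a s) f = K.add (f a) (K.sum s f) := by
  cases K <;> simp [sum, add, ha]

theorem sum_congr (K : Alg) {s : Finset ι} {f g : ι → ℝ≥0} (h : ∀ i ∈ s, f i = g i) :
    K.sum s f = K.sum s g := by
  cases K
  · exact Finset.sum_congr rfl h
  · exact Finset.sup_congr rfl h

theorem sum_mono (K : Alg) {s : Finset ι} {f g : ι → ℝ≥0} (h : ∀ i ∈ s, f i ≤ g i) :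
    K.sum s f ≤ K.sum s g := by
  cases K
  · exact Finset.sum_le_sum h
  · exact Finset.sup_mono_fun h

theorem le_sum (K : Alg) {s : Finset ι} (f : ι → ℝ≥0) {i : ι} (hi : i ∈ s) : f i ≤ K.sum s f := by
  cases K
  · exact Finset.single_le_sum (fun _ _ => zero_le) hi
  · exact Finset.le_sup hi

theorem sum_eq_zero (K : Alg) {s : Finset ι} {f : ι → ℝ≥0} (h : ∀ i ∈ s, f i = 0) :
    K.sum s f = 0 := by
  cases K
  · exact Finset.sum_eq_zero h
  · exact (Finset.sup_eq_bot_iff f s).2 h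

theorem exists_ne_zero_of_sum_ne_zero (K : Alg) {s : Finset ι} {f : ι → ℝ≥0}
    (h : K.sum s f ≠ 0) : ∃ i ∈ s, f i ≠ 0 := by
  by_contra! h'
  exact h (K.sum_eq_zero h')

theorem mul_sum (K : Alg) (s : Finset ι) (a : ℝ≥0) (f : ι → ℝ≥0) :
    a * K.sum s f = K.sum s fun i => a * f i := by
  cases K
  · exact Finset.mul_sum s f a
  · exact NNReal.mul_finset_sup a s f

theorem sum_mul (K : Alg) (s : Finset ι) (a : ℝ≥0) (f : ι → ℝ≥0) :
    K.sum s f * a = K.sum s fun i => f i * a := by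
  simp only [mul_comm _ a, mul_sum]

theorem sum_comm (K : Alg) (s : Finset ι) (t : Finset κ) (f : ι → κ → ℝ≥0) :
    (K.sum s fun i => K.sum t (f i)) = K.sum t fun j => K.sum s fun i => f i j := by
  cases K
  · exact Finset.sum_comm
  · exact Finset.sup_comm s t f

theorem sum_mono_set (K : Alg) {s t : Finset ι} (h : s ⊆ t) (f : ι → ℝ≥0) :
    K.sum s f ≤ K.sum t f := by
  cases K
  · exact Finset.sum_le_sum_of_subset h
  · exact Finset.sup_mono h

theorem sum_union [DecidableEq ι] (K : Alg) {s t : Finset ι} (h : Disjoint s t) (f : ι → ℝ≥0) :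
    K.sum (s ∪ t) f = K.add (K.sum s f) (K.sum t f) := by
  cases K
  · exact Finset.sum_union h
  · exact Finset.sup_union

theorem sum_subtype (K : Alg) (s : Finset ι) (f : ι → ℝ≥0) :
    (K.sum Finset.univ fun i : s => f i) = K.sum s f := by
  cases K
  · exact Finset.sum_coe_sort s f
  · change Finset.univ.sup (fun i : s => f i) = s.sup f
    rw [Finset.univ_eq_attach]
    exact Finset.sup_attach s f

theorem continuous_sum {X : Type*} [TopologicalSpace X] (K : Alg) (s : Finset ι)
    {f : ι → X → ℝ≥0} (h : ∀ i, Continuous (f i)) : Continuous fun x => K.sum s fun i => f i x := by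
  cases K
  · exact continuous_finsetSum s fun i _ => h i
  · exact Continuous.finset_sup_apply fun i _ => h i

/-- Telescoping without subtraction, which max algebra does not have. -/
theorem sum_range_shift (K : Alg) (m : ℕ) (f : ℕ → ℝ≥0) :
    K.add (f 0) (K.sum (Finset.range m) fun i => f (i + 1)) =
      K.add (f m) (K.sum (Finset.range m) f) := by
  have h (m : ℕ) (g : ℕ → ℝ≥0) :
      K.sum (Finset.range (m + 1)) g = K.add (g m) (K.sum (Finset.range m) g) := by
    rw [Finset.range_add_one, K.sum_insert Finset.notMem_range_self]
  induction m with
  | zero => simp [sum_empty]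
  | succ m ih => rw [h, h, ← ih, ← add_assoc, ← add_assoc, K.add_comm (f 0)]

section Vec

variable [Fintype ι]

theorem mulVec_mono (K : Alg) (A : Matrix ι ι ℝ≥0) : Monotone (K.mulVec A) := fun _ _ h _ =>
  K.sum_mono fun j _ => mul_le_mul_right (h j) _

theorem mulVec_smul (K : Alg) (A : Matrix ι ι ℝ≥0) (c : ℝ≥0) (x : ι → ℝ≥0) :
    K.mulVec A (c • x) = c • K.mulVec A x := by
  ext i : 1
  simp only [mulVec, Pi.smul_apply, smul_eq_mul, mul_sum]
  exact K.sum_congr fun j _ => by ring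

theorem smul_mulVec (K : Alg) (A : Matrix ι ι ℝ≥0) (c : ℝ≥0) (x : ι → ℝ≥0) :
    K.mulVec (c • A) x = c • K.mulVec A x := by
  ext i : 1
  simp only [mulVec, Pi.smul_apply, Matrix.smul_apply, smul_eq_mul, mul_sum]
  exact K.sum_congr fun j _ => by ring

theorem mulVec_sum (K : Alg) (A : Matrix ι ι ℝ≥0) (s : Finset κ) (x : κ → ι → ℝ≥0) :
    (K.mulVec A fun i => K.sum s fun a => x a i) = fun i =>
      K.sum s fun a => K.mulVec A (x a) i := by
  ext i : 1
  simp only [mulVec, mul_sum]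
  exact K.sum_comm _ _ _

theorem mulVec_zero (K : Alg) (A : Matrix ι ι ℝ≥0) : K.mulVec A 0 = 0 :=
  funext fun i => K.sum_eq_zero fun j _ => mul_zero (A i j)

theorem continuous_mulVec (K : Alg) (A : Matrix ι ι ℝ≥0) : Continuous (K.mulVec A) :=
  continuous_pi fun _ => K.continuous_sum _ fun j => continuous_const.mul (continuous_apply j)

theorem mulVec_mul (K : Alg) (A B : Matrix ι ι ℝ≥0) (x : ι → ℝ≥0) :
    K.mulVec (K.mul A B) x = K.mulVec A (K.mulVec B x) := by
  ext i : 1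
  simp only [mulVec, mul, Matrix.of_apply, sum_mul, mul_sum]
  rw [sum_comm]
  simp only [mul_assoc]

theorem mulVec_one [DecidableEq ι] (K : Alg) (x : ι → ℝ≥0) : K.mulVec 1 x = x := by
  ext i : 1
  refine le_antisymm ?_ ?_
  · have h : insert i (Finset.univ.erase i) = Finset.univ := Finset.insert_erase (Finset.mem_univ i)
    rw [mulVec, ← h, K.sum_insert (Finset.notMem_erase _ _), K.sum_eq_zero, add_zero,
      Matrix.one_apply_eq, one_mul]
    intro j hj
    rw [Matrix.one_apply_ne (Finset.ne_of_mem_erase hj).symm, zero_mul]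
  · simpa only [Matrix.one_apply_eq, one_mul, mulVec] using
      K.le_sum (fun j => (1 : Matrix ι ι ℝ≥0) i j * x j) (Finset.mem_univ i)

theorem mulVec_pow [DecidableEq ι] (K : Alg) (A : Matrix ι ι ℝ≥0) (k : ℕ) (x : ι → ℝ≥0) :
    K.mulVec (K.pow A k) x = (K.mulVec A)^[k] x := by
  induction k generalizing x with
  | zero => exact K.mulVec_one x
  | succ k ih => rw [pow, mulVec_mul, ih, Function.iterate_succ_apply]

theorem mul_le_mulVec (K : Alg) (A : Matrix ι ι ℝ≥0) (x : ι → ℝ≥0) (i j : ι) :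
    A i j * x j ≤ K.mulVec A x i :=
  K.le_sum (fun j => A i j * x j) (Finset.mem_univ j)

end Vec

end Alg

/-! ### Sub-eigenvectors and Perron–Frobenius theory -/

namespace Alg

/-- The form of cancellation that survives in max algebra: there `hac` makes the right side equal to
`c`. -/
theorem le_of_add_le_add (K : Alg) {a b c : ℝ≥0} (h : K.add a b ≤ K.add a c) (hac : a ≤ c) :
    b ≤ c := by
  cases K
  · exact le_of_add_le_add_left h
  · exact ((le_max_right a b).trans h).trans (max_le hac le_rfl)

end Alg

/-- Take `c` to be the largest ratio `z i / x i`; with division by zero giving 0, indices off the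
support of `x` do no harm. -/
theorem exists_touching {ι : Type*} [Fintype ι] {x z : ι → ℝ≥0} (hz : z ≠ 0)
    (h : ∀ i, z i ≠ 0 → x i ≠ 0) :
    ∃ (c : ℝ≥0) (i : ι), z ≤ c • x ∧ z i = c * x i ∧ z i ≠ 0 := by
  obtain ⟨j, hj⟩ := Function.ne_iff.1 hz
  obtain ⟨i, -, hi⟩ :=
    Finset.exists_max_image Finset.univ (fun i => z i / x i) ⟨j, Finset.mem_univ j⟩
  have hzi : z i ≠ 0 := by
    intro h0
    have := hi j (Finset.mem_univ j)
    simp only [h0, zero_div, nonpos_iff_eq_zero, div_eq_zero_iff] at this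
    exact this.elim hj (h j hj)
  refine ⟨z i / x i, i, fun l => ?_, (div_mul_cancel₀ _ (h i hzi)).symm, hzi⟩
  by_cases hl : x l = 0
  · have : z l = 0 := by
      by_contra h0
      exact h l h0 hl
    simp [this]
  · calc z l = z l / x l * x l := (div_mul_cancel₀ _ hl).symm
      _ ≤ z i / x i * x l := mul_le_mul_left (hi l (Finset.mem_univ l)) _

namespace Alg

variable {ι : Type*} [Fintype ι]

theorem ne_zero_of_hasPath (K : Alg) {A : Matrix ι ι ℝ≥0} {r : ℝ≥0} {x : ι → ℝ≥0}
    (hx : K.mulVec A x ≤ r • x) {i j : ι} (h : HasPath A i j) (hj : x j ≠ 0) : x i ≠ 0 := by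
  induction h using Relation.ReflTransGen.head_induction_on with
  | refl => exact hj
  | @head a b hab _ ih =>
    intro h0
    have h1 := (K.mul_le_mulVec A x a b).trans (hx a)
    rw [Pi.smul_apply, h0, smul_zero, nonpos_iff_eq_zero] at h1
    exact mul_ne_zero hab ih h1

/-- Scale `x` until it touches `z` from above, then compare the two images at the touching index. -/
theorem eigenvalue_le (K : Alg) {A : Matrix ι ι ℝ≥0} {r s : ℝ≥0} {x z : ι → ℝ≥0} (hz : z ≠ 0)
    (hzr : K.mulVec A z = r • z) (hx : K.mulVec A x ≤ s • x) (h : ∀ i, z i ≠ 0 → x i ≠ 0) :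
    r ≤ s := by
  obtain ⟨c, i, hc, hi, hi0⟩ := exists_touching hz h
  have h1 : r * z i ≤ s * z i := calc
    r * z i = K.mulVec A z i := (congrFun hzr i).symm
    _ ≤ K.mulVec A (c • x) i := K.mulVec_mono A hc i
    _ = c * K.mulVec A x i := congrFun (K.mulVec_smul A c x) i
    _ ≤ c * (s * x i) := mul_le_mul_right (hx i) _
    _ = s * z i := by rw [hi]; ring
  exact le_of_mul_le_mul_right h1 (pos_iff_ne_zero.2 hi0)

/-- Compactness: vectors of max norm 1, paired with values at most the largest row sum `R`, form a
compact set of candidates, nonempty because of the all-ones vector. -/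
theorem exists_minimal_subeigenvector [Nonempty ι] (K : Alg) (A : Matrix ι ι ℝ≥0) :
    ∃ (s : ℝ≥0) (v : ι → ℝ≥0), v ≠ 0 ∧ K.mulVec A v ≤ s • v ∧
      ∀ (r : ℝ≥0) (w : ι → ℝ≥0), w ≠ 0 → K.mulVec A w ≤ r • w → s ≤ r := by
  set R : ℝ≥0 := Finset.univ.sup (K.mulVec A 1)
  let N : (ι → ℝ≥0) → ℝ≥0 := fun x => Alg.max.sum Finset.univ fun i => x i
  have hN : Continuous N := Alg.max.continuous_sum _ fun i => continuous_apply i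
  let C : Set (ℝ≥0 × (ι → ℝ≥0)) :=
    Set.Icc (0, 0) (R, 1) ∩ {p | N p.2 = 1 ∧ K.mulVec A p.2 ≤ p.1 • p.2}
  have hC : IsCompact C := by
    refine isCompact_Icc.inter_right (IsClosed.inter ?_ ?_)
    · exact isClosed_eq (hN.comp continuous_snd) continuous_const
    · exact isClosed_le ((K.continuous_mulVec A).comp continuous_snd)
        (continuous_fst.smul continuous_snd)
  have hle (x : ι → ℝ≥0) (i : ι) : x i ≤ N x := Alg.max.le_sum (fun i => x i) (Finset.mem_univ i)
  have h1 : N 1 = 1 := Finset.sup_const Finset.univ_nonempty 1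
  have hR : K.mulVec A 1 ≤ R • (1 : ι → ℝ≥0) := fun i => by
    simpa using Finset.le_sup (f := K.mulVec A 1) (Finset.mem_univ i)
  have h1C : (R, (1 : ι → ℝ≥0)) ∈ C := ⟨⟨⟨zero_le, fun _ => zero_le⟩, le_rfl⟩, h1, hR⟩
  obtain ⟨⟨s, v⟩, ⟨⟨-, hsv⟩, hv1, hv⟩, hmin⟩ :=
    hC.exists_isMinOn ⟨_, h1C⟩ continuous_fst.continuousOn
  refine ⟨s, v, ?_, hv, fun r w hw hwr => ?_⟩
  · rintro rfl
    have : N (0 : ι → ℝ≥0) = 0 := Alg.max.sum_eq_zero fun _ _ => rfl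
    exact zero_ne_one (this.symm.trans hv1)
  · rcases le_total R r with h | h
    · exact hsv.1.trans h
    · have hw0 : N w ≠ 0 := by
        intro h0
        exact hw (funext fun i => nonpos_iff_eq_zero.1 ((hle w i).trans h0.le))
      have hnorm : N ((N w)⁻¹ • w) = 1 := by
        have := Alg.max.mul_sum Finset.univ (N w)⁻¹ w
        exact this.symm.trans (inv_mul_cancel₀ hw0)
      refine hmin (show (r, (N w)⁻¹ • w) ∈ C from
        ⟨⟨⟨zero_le, fun _ => zero_le⟩, h, fun i => (hle _ i).trans hnorm.le⟩, hnorm, ?_⟩)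
      change K.mulVec A ((N w)⁻¹ • w) ≤ r • ((N w)⁻¹ • w)
      rw [mulVec_smul, smul_comm]
      exact fun i => mul_le_mul_right (hwr i) _

/-- With $t^m=2$, the vector $w=\sum_{a<m}t^aB^av$ works: applying $tB$ shifts the sum, exchanging
$v$ for $2B^mv\le v$. -/
theorem exists_mulVec_le_of_iterate_le (K : Alg) {B : Matrix ι ι ℝ≥0} {v : ι → ℝ≥0} {m : ℕ}
    (hm : m ≠ 0) (h : ∀ i, 2 * (K.mulVec B)^[m] v i ≤ v i) (hv : v ≠ 0) :
    ∃ (t : ℝ≥0) (w : ι → ℝ≥0), 1 < t ∧ w ≠ 0 ∧ K.mulVec B w ≤ t⁻¹ • w := by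
  obtain ⟨t, ht, htm⟩ : ∃ t : ℝ≥0, 1 < t ∧ t ^ m = 2 :=
    ⟨2 ^ (m : ℝ)⁻¹, NNReal.one_lt_rpow one_lt_two (by positivity),
      NNReal.rpow_inv_natCast_pow 2 hm⟩
  have ht0 : t ≠ 0 := (zero_lt_one.trans ht).ne'
  set u : ℕ → ι → ℝ≥0 := fun a => (K.mulVec B)^[a] v with hu
  set w : ι → ℝ≥0 := fun i => K.sum (Finset.range m) fun a => (t ^ a • u a) i with hw
  have hvw : v ≤ w := fun i => by
    have := K.le_sum (fun a => (t ^ a • u a) i) (Finset.mem_range.2 (Nat.pos_of_ne_zero hm))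
    rwa [pow_zero, one_smul] at this
  refine ⟨t, w, ht, fun h0 => hv (le_antisymm (hvw.trans h0.le) fun _ => zero_le), fun i => ?_⟩
  have h1 : t * K.mulVec B w i = K.sum (Finset.range m) fun a => (t ^ (a + 1) • u (a + 1)) i := by
    rw [hw, K.mulVec_sum, mul_sum]
    refine K.sum_congr fun a _ => ?_
    rw [mulVec_smul, hu]
    simp only [Function.iterate_succ_apply', Pi.smul_apply, smul_eq_mul]
    ring
  have h2 : t * K.mulVec B w i ≤ w i := by
    refine K.le_of_add_le_add (a := v i) ?_ (hvw i)
    have h3 := K.sum_range_shift m fun a => (t ^ a • u a) i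
    rw [← h1] at h3
    refine le_trans (le_of_eq ?_) (h3.le.trans (K.add_mono ?_ le_rfl))
    · simp [hu]
    · simpa [hu, htm] using h i
  rw [Pi.smul_apply, smul_eq_mul, le_inv_mul_iff₀ (zero_lt_one.trans ht)]
  exact h2

-- The iterates of `v` decrease to a fixed point; if it is zero, some iterate is at most half of
-- `v`, since `v` is positive everywhere.
open Filter Topology in
theorem exists_fixedPoint_or_iterate_le (K : Alg) {B : Matrix ι ι ℝ≥0} {v : ι → ℝ≥0}
    (hv : ∀ i, v i ≠ 0) (h : K.mulVec B v ≤ v) :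
    (∃ x, x ≠ 0 ∧ K.mulVec B x = x) ∨ ∃ m ≠ 0, ∀ i, 2 * (K.mulVec B)^[m] v i ≤ v i := by
  have hanti : Antitone fun m => (K.mulVec B)^[m] v := antitone_nat_of_succ_le fun m => by
    rw [Function.iterate_succ_apply]
    exact (K.mulVec_mono B).iterate m h
  set x : ι → ℝ≥0 := fun i => ⨅ m, (K.mulVec B)^[m] v i
  have hlim : Tendsto (fun m => (K.mulVec B)^[m] v) atTop (𝓝 x) := tendsto_pi_nhds.2 fun i =>
    tendsto_atTop_ciInf (fun _ _ hab => hanti hab i) (OrderBot.bddBelow _)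
  have hfix := isFixedPt_of_tendsto_iterate hlim (K.continuous_mulVec B).continuousAt
  by_cases hx : x = 0
  · right
    have hev : ∀ᶠ m in atTop, ∀ i, 2 * (K.mulVec B)^[m] v i ≤ v i := by
      refine eventually_all.2 fun i => ?_
      have h1 : Tendsto (fun m => 2 * (K.mulVec B)^[m] v i) atTop (𝓝 (2 * x i)) :=
        (tendsto_pi_nhds.1 hlim i).const_mul 2
      rw [hx, Pi.zero_apply, mul_zero] at h1
      exact (h1.eventually_lt_const (pos_iff_ne_zero.2 (hv i))).mono fun _ => le_of_lt
    obtain ⟨m, hm, hm0⟩ := (hev.and (eventually_ne_atTop 0)).exists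
    exact ⟨m, hm0, hm⟩
  · exact Or.inl ⟨x, hx, hfix⟩

/-- The Perron–Frobenius theorem: an irreducible matrix has an eigenvector. -/
theorem exists_isEigenvalue [Nonempty ι] (K : Alg) {A : Matrix ι ι ℝ≥0}
    (hA : ∀ i j, HasPath A i j) : ∃ r, K.IsEigenvalue A r := by
  obtain ⟨s, v, hv, hsv, hmin⟩ := K.exists_minimal_subeigenvector A
  obtain ⟨j, hj⟩ := Function.ne_iff.1 hv
  refine ⟨s, ?_⟩
  by_cases hs : s = 0
  · refine ⟨v, hv, le_antisymm hsv ?_⟩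
    rw [hs, zero_smul]
    exact fun _ => zero_le
  have hle : K.mulVec (s⁻¹ • A) v ≤ v := by
    rw [smul_mulVec, inv_smul_le_iff_of_pos (pos_iff_ne_zero.2 hs)]
    exact hsv
  rcases K.exists_fixedPoint_or_iterate_le (fun i => K.ne_zero_of_hasPath hsv (hA i j) hj) hle with
    ⟨x, hx, hfix⟩ | ⟨m, hm, hlt⟩
  · exact ⟨x, hx, by rwa [smul_mulVec, inv_smul_eq_iff₀ hs] at hfix⟩
  -- Decay of the iterates would give a sub-eigenvector for $s/t<s$, against minimality of `s`.
  · obtain ⟨t, w, ht, hw, hwt⟩ := K.exists_mulVec_le_of_iterate_le hm hlt hv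
    have h1 : K.mulVec A w ≤ (s * t⁻¹) • w := by
      rw [smul_mulVec, inv_smul_le_iff_of_pos (pos_iff_ne_zero.2 hs), smul_smul] at hwt
      exact hwt
    have h2 := hmin _ w hw h1
    have h3 : s * t⁻¹ < s :=
      mul_lt_of_lt_one_right (pos_iff_ne_zero.2 hs) (inv_lt_one_of_one_lt₀ ht)
    exact absurd h2 h3.not_ge

theorem IsEigenvalue.le_of_irreducible {K : Alg} {A : Matrix ι ι ℝ≥0} (hA : ∀ i j, HasPath A i j)
    {r s : ℝ≥0} (hr : K.IsEigenvalue A r) {x : ι → ℝ≥0} (hx : x ≠ 0)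
    (hxs : K.mulVec A x ≤ s • x) : r ≤ s := by
  obtain ⟨z, hz, hzr⟩ := hr
  obtain ⟨j, hj⟩ := Function.ne_iff.1 hx
  exact K.eigenvalue_le hz hzr hxs fun i _ => K.ne_zero_of_hasPath hxs (hA i j) hj

theorem IsEigenvalue.eq_principalEigenvalue {K : Alg} {A : Matrix ι ι ℝ≥0}
    (hA : ∀ i j, HasPath A i j) {r : ℝ≥0} (hr : K.IsEigenvalue A r) :
    r = K.principalEigenvalue A := by
  have h : {s | K.IsEigenvalue A s} = {r} := by
    refine Set.eq_singleton_iff_unique_mem.2 ⟨hr, fun s hs => ?_⟩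
    obtain ⟨x, hx, hxr⟩ := id hr
    obtain ⟨z, hz, hzs⟩ := id hs
    exact le_antisymm (hs.le_of_irreducible hA hx hxr.le) (hr.le_of_irreducible hA hz hzs.le)
  rw [principalEigenvalue, h, csSup_singleton]

section Irreducible

variable [Nonempty ι] {K : Alg} {A : Matrix ι ι ℝ≥0}

theorem isEigenvalue_principalEigenvalue (K : Alg) (hA : ∀ i j, HasPath A i j) :
    K.IsEigenvalue A (K.principalEigenvalue A) := by
  obtain ⟨r, hr⟩ := K.exists_isEigenvalue hA
  rwa [← hr.eq_principalEigenvalue hA]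

theorem principalEigenvalue_le (hA : ∀ i j, HasPath A i j) {s : ℝ≥0} {x : ι → ℝ≥0} (hx : x ≠ 0)
    (hxs : K.mulVec A x ≤ s • x) : K.principalEigenvalue A ≤ s :=
  (K.isEigenvalue_principalEigenvalue hA).le_of_irreducible hA hx hxs

/-- If equality held, scale `x` to touch an eigenvector `z`. The difference `w` is a sub-eigenvector
vanishing at the touching index, hence zero by irreducibility, so `x` is itself an eigenvector and
no inequality is strict. -/
theorem principalEigenvalue_lt (hA : ∀ i j, HasPath A i j) {s : ℝ≥0} {x : ι → ℝ≥0}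
    (hxs : nonneg.mulVec A x ≤ s • x) {i : ι} (hi : nonneg.mulVec A x i < s * x i) :
    nonneg.principalEigenvalue A < s := by
  have hx : x ≠ 0 := by
    rintro rfl
    simp at hi
  refine (principalEigenvalue_le hA hx hxs).lt_of_ne fun heq => ?_
  obtain ⟨z, hz, hzs⟩ := nonneg.isEigenvalue_principalEigenvalue hA
  rw [heq] at hzs
  obtain ⟨j, hj⟩ := Function.ne_iff.1 hx
  obtain ⟨c, a, hc, hca, hza⟩ :=
    exists_touching hz fun i _ => nonneg.ne_zero_of_hasPath hxs (hA i j) hj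
  obtain ⟨w, hw⟩ : ∃ w, c • x = z + w := ⟨c • x - z, (add_tsub_cancel_of_le hc).symm⟩
  have hadd : nonneg.mulVec A (c • x) = s • z + nonneg.mulVec A w := by
    rw [hw, ← hzs]
    exact Matrix.mulVec_add A z w
  have hcs : nonneg.mulVec A (c • x) ≤ s • (c • x) := by
    rw [mulVec_smul, smul_comm]
    exact fun i => mul_le_mul_right (hxs i) _
  have hws : nonneg.mulVec A w ≤ s • w := by
    rw [hadd, hw, smul_add] at hcs
    exact fun i => le_of_add_le_add_left (hcs i)
  have hwa : w a = 0 := by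
    have := congrFun hw a
    rw [Pi.smul_apply, smul_eq_mul, ← hca, Pi.add_apply] at this
    exact left_eq_add.1 this
  have hw0 : w = 0 := by
    by_contra h0
    obtain ⟨b, hb⟩ := Function.ne_iff.1 h0
    exact nonneg.ne_zero_of_hasPath hws (hA a b) hb hwa
  have hc0 : c ≠ 0 := by
    rintro rfl
    exact hza (by simpa using hca)
  rw [hw0, _root_.add_zero] at hw
  rw [← hw, mulVec_smul] at hzs
  have h1 := congrFun hzs i
  simp only [Pi.smul_apply, smul_eq_mul] at h1
  rw [mul_left_comm] at h1
  exact hi.ne (mul_left_cancel₀ hc0 h1)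

end Irreducible

end Alg

/-! ### Classes, access and Perron roots -/

section Paths

variable {ι : Type*} {A : Matrix ι ι ℝ≥0}

theorem HasPath.refl (i : ι) : HasPath A i i := Relation.ReflTransGen.refl

theorem HasPath.trans {i j l : ι} (h : HasPath A i j) (h' : HasPath A j l) : HasPath A i l :=
  Relation.ReflTransGen.trans h h'

theorem HasPath.of_ne_zero {i j : ι} (h : A i j ≠ 0) : HasPath A i j :=
  Relation.ReflTransGen.single h

theorem HasPath.exists_exit {N : Finset ι} {a j : ι} (h : HasPath A a j) (ha : a ∈ N)
    (hj : j ∉ N) : ∃ b ∈ N, ∃ l ∉ N, A b l ≠ 0 ∧ HasPath A l j := by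
  induction h using Relation.ReflTransGen.head_induction_on with
  | refl => exact absurd ha hj
  | @head a b hab hbj ih =>
    by_cases hb : b ∈ N
    · exact ih hb
    · exact ⟨a, ha, b, hb, hab, hbj⟩

namespace MatrixClass

theorem mem_nodes_iff {μ : MatrixClass A} {i : ι} (hi : i ∈ μ.nodes) (j : ι) :
    j ∈ μ.nodes ↔ HasPath A i j ∧ HasPath A j i := by
  obtain ⟨N, a, ha⟩ := μ
  have hai := (ha i).1 hi
  refine (ha j).trans ⟨fun h => ⟨hai.2.trans h.1, h.2.trans hai.1⟩, fun h =>
    ⟨hai.1.trans h.1, h.2.trans hai.2⟩⟩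

theorem nodes_nonempty (μ : MatrixClass A) : μ.nodes.Nonempty := by
  obtain ⟨N, a, ha⟩ := μ
  exact ⟨a, (ha a).2 ⟨.refl _, .refl _⟩⟩

theorem eq_of_mem_of_mem {μ ν : MatrixClass A} {i : ι} (hμ : i ∈ μ.nodes) (hν : i ∈ ν.nodes) :
    μ = ν :=
  Subtype.ext (Finset.ext fun j => (mem_nodes_iff hμ j).trans (mem_nodes_iff hν j).symm)

theorem hasPath_submatrix (μ : MatrixClass A) (i j : μ.nodes) :
    HasPath (A.submatrix (Subtype.val : μ.nodes → ι) (Subtype.val : μ.nodes → ι)) i j := by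
  obtain ⟨i, hi⟩ := i
  obtain ⟨j, hj⟩ := j
  have h : HasPath A i j := ((mem_nodes_iff hi j).1 hj).1
  induction h using Relation.ReflTransGen.head_induction_on with
  | refl => exact .refl _
  | @head a b hab hbj ih =>
    have hb : b ∈ μ.nodes :=
      (mem_nodes_iff hi b).2 ⟨.of_ne_zero hab, hbj.trans ((mem_nodes_iff hi j).1 hj).2⟩
    exact .head (b := (⟨b, hb⟩ : μ.nodes)) (show A a b ≠ 0 from hab) (ih hb)

theorem submatrix_mulVec (K : Alg) (μ : MatrixClass A) (x : ι → ℝ≥0) (i : μ.nodes) :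
    K.mulVec (A.submatrix (Subtype.val : μ.nodes → ι) (Subtype.val : μ.nodes → ι))
      (fun l => x l) i = K.sum μ.nodes fun j => A i j * x j :=
  K.sum_subtype μ.nodes fun j => A i j * x j

instance (μ : MatrixClass A) : Nonempty μ.nodes := μ.nodes_nonempty.to_subtype

theorem exists_perronVector (K : Alg) (μ : MatrixClass A) :
    ∃ y : ι → ℝ≥0, (∀ i ∈ μ.nodes, y i ≠ 0) ∧
      ∀ i ∈ μ.nodes, (K.sum μ.nodes fun j => A i j * y j) = μ.perronRoot K * y i := by
  classical
  obtain ⟨z, hz, hzr⟩ := K.isEigenvalue_principalEigenvalue μ.hasPath_submatrix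
  obtain ⟨j, hj⟩ := Function.ne_iff.1 hz
  set y : ι → ℝ≥0 := fun i => if h : i ∈ μ.nodes then z ⟨i, h⟩ else 0 with hy
  have hyz : (fun l : μ.nodes => y l) = z := funext fun l => by simp [hy]
  have hyi (i : ι) (hi : i ∈ μ.nodes) : y i = z ⟨i, hi⟩ := dif_pos hi
  refine ⟨y, fun i hi => ?_, fun i hi => ?_⟩
  · rw [hyi i hi]
    exact K.ne_zero_of_hasPath hzr.le (μ.hasPath_submatrix ⟨i, hi⟩ j) hj
  · rw [← submatrix_mulVec K μ y ⟨i, hi⟩, hyz, hzr, hyi i hi]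
    rfl

/-- Puts the two definitions of spectral class in one form: a class accessing `ν` leaves room `ε`.
In max algebra `ε = ρ` fits even when the Perron roots are equal. -/
theorem IsSpectral.exists_add_le {K : Alg} {ν : MatrixClass A} {ρ : ℝ≥0}
    (hν : ν.IsSpectral K ρ) {μ : MatrixClass A} (hμ : μ.Accesses ν) (hne : μ ≠ ν) :
    ∃ ε, ε ≠ 0 ∧ K.add (μ.perronRoot K) ε ≤ ρ := by
  obtain ⟨hρ, rfl, h⟩ := hν
  cases K with
  | nonneg =>
    exact ⟨_, (tsub_pos_of_lt (h μ hμ hne)).ne', (add_tsub_cancel_of_le (h μ hμ hne).le).le⟩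
  | max => exact ⟨_, hρ, max_le (h μ hμ) le_rfl⟩

variable [Fintype ι]

open Classical in
/-- The class of a node. -/
def of (A : Matrix ι ι ℝ≥0) (i : ι) : MatrixClass A :=
  ⟨Finset.univ.filter fun j => HasPath A i j ∧ HasPath A j i, i, fun j => by simp⟩

theorem mem_nodes_of (A : Matrix ι ι ℝ≥0) (i : ι) : i ∈ (of A i).nodes := by
  simp only [of, nodes, Finset.mem_filter, Finset.mem_univ, true_and]
  exact ⟨.refl _, .refl _⟩

theorem of_eq {μ : MatrixClass A} {i : ι} (hi : i ∈ μ.nodes) : of A i = μ :=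
  eq_of_mem_of_mem (mem_nodes_of A i) hi

theorem accesses_iff {μ ν : MatrixClass A} {i j : ι} (hi : i ∈ μ.nodes) (hj : j ∈ ν.nodes) :
    μ.Accesses ν ↔ HasPath A i j := by
  constructor
  · intro h
    induction h generalizing j with
    | refl => exact ((mem_nodes_iff hi j).1 hj).1
    | tail _ hbc ih =>
      obtain ⟨k, hk, l, hl, hkl⟩ := hbc
      exact ((ih hk).trans (.of_ne_zero hkl.ne')).trans ((mem_nodes_iff hl j).1 hj).1
  · intro h
    induction h generalizing ν with
    | refl => exact eq_of_mem_of_mem hi hj ▸ .refl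
    | @tail b c _ hbc ih =>
      exact (ih (mem_nodes_of A b)).tail ⟨b, mem_nodes_of A b, c, hj, pos_iff_ne_zero.2 hbc⟩

theorem nodeAccesses_iff {ν : MatrixClass A} {i j : ι} (hj : j ∈ ν.nodes) :
    NodeAccesses i ν ↔ HasPath A i j :=
  ⟨fun ⟨_, hi, h⟩ => (accesses_iff hi hj).1 h,
    fun h => ⟨of A i, mem_nodes_of A i, (accesses_iff (mem_nodes_of A i) hj).2 h⟩⟩

theorem submatrix_mulVec_le (K : Alg) (μ : MatrixClass A) {x : ι → ℝ≥0} {s : ℝ≥0}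
    (h : K.mulVec A x ≤ s • x) :
    K.mulVec (A.submatrix (Subtype.val : μ.nodes → ι) (Subtype.val : μ.nodes → ι))
      (fun l => x l) ≤ s • fun l : μ.nodes => x l := fun i => by
  rw [submatrix_mulVec]
  exact (K.sum_mono_set (Finset.subset_univ _) _).trans (h i)

theorem perronRoot_le (K : Alg) (μ : MatrixClass A) {x : ι → ℝ≥0} {s : ℝ≥0}
    (h : K.mulVec A x ≤ s • x) {i : ι} (hi : i ∈ μ.nodes) (hx : x i ≠ 0) :
    μ.perronRoot K ≤ s := by
  refine Alg.principalEigenvalue_le μ.hasPath_submatrix (x := fun l => x l) ?_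
    (submatrix_mulVec_le K μ h)
  exact fun h0 => hx (congrFun h0 ⟨i, hi⟩)

theorem mulVec_eq_add [DecidableEq ι] (K : Alg) (N : Finset ι) (x : ι → ℝ≥0) (i : ι) :
    K.mulVec A x i = K.add (K.sum N fun j => A i j * x j) (K.sum Nᶜ fun j => A i j * x j) := by
  rw [← K.sum_union disjoint_compl_right, Finset.union_compl]
  rfl

theorem perronRoot_lt (μ : MatrixClass A) {x : ι → ℝ≥0} {s : ℝ≥0}
    (h : Alg.nonneg.mulVec A x ≤ s • x) {i l : ι} (hi : i ∈ μ.nodes) (hl : l ∉ μ.nodes)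
    (hil : A i l ≠ 0) (hx : x l ≠ 0) : μ.perronRoot Alg.nonneg < s := by
  classical
  refine Alg.principalEigenvalue_lt μ.hasPath_submatrix (submatrix_mulVec_le _ μ h)
    (i := ⟨i, hi⟩) ?_
  rw [submatrix_mulVec]
  refine lt_of_lt_of_le ?_ (h i)
  rw [mulVec_eq_add Alg.nonneg μ.nodes x i]
  refine lt_add_of_pos_right _ (lt_of_lt_of_le (pos_iff_ne_zero.2 (mul_ne_zero hil hx)) ?_)
  exact Alg.nonneg.le_sum (fun j => A i j * x j) (Finset.mem_compl.2 hl)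

theorem perronRoot_eq (K : Alg) (μ : MatrixClass A) {x : ι → ℝ≥0} {s : ℝ≥0}
    (h : K.mulVec A x = s • x) {i : ι} (hi : i ∈ μ.nodes) (hx : x i ≠ 0)
    (hfinal : ∀ a ∈ μ.nodes, ∀ l ∉ μ.nodes, A a l * x l = 0) : μ.perronRoot K = s := by
  classical
  refine (Alg.IsEigenvalue.eq_principalEigenvalue μ.hasPath_submatrix ⟨fun l => x l, ?_, ?_⟩).symm
  · exact fun h0 => hx (congrFun h0 ⟨i, hi⟩)
  · ext a : 1
    rw [submatrix_mulVec, Pi.smul_apply]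
    change _ = (s • x) a
    rw [← h, mulVec_eq_add K μ.nodes, K.sum_eq_zero (s := μ.nodesᶜ), K.add_zero]
    exact fun l hl => hfinal a a.2 l (Finset.mem_compl.1 hl)

theorem exists_perronVectors (K : Alg) (A : Matrix ι ι ℝ≥0) :
    ∃ v : ι → ℝ≥0, (∀ i, v i ≠ 0) ∧ ∀ i,
      (K.sum (of A i).nodes fun j => A i j * v j) = (of A i).perronRoot K * v i := by
  choose y hy hyr using fun μ : MatrixClass A => exists_perronVector K μ
  refine ⟨fun i => y (of A i) i, fun i => hy _ i (mem_nodes_of A i), fun i => ?_⟩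
  rw [← hyr _ i (mem_nodes_of A i)]
  exact K.sum_congr fun j hj => by simp only [of_eq hj]

end MatrixClass

/-! ### Spectral classes and supports of eigenvectors -/

variable [Fintype ι]

open Classical in
/-- The nodes to which there is a path from `i`. -/
def reach (A : Matrix ι ι ℝ≥0) (i : ι) : Finset ι :=
  Finset.univ.filter fun j => HasPath A i j

theorem mem_reach {i j : ι} : j ∈ reach A i ↔ HasPath A i j := by simp [reach]

theorem reach_card_pos (A : Matrix ι ι ℝ≥0) (i : ι) : 0 < (reach A i).card :=
  Finset.card_pos.2 ⟨i, mem_reach.2 (.refl i)⟩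

theorem HasPath.reach_subset {i j : ι} (h : HasPath A i j) : reach A j ⊆ reach A i :=
  fun _ hl => mem_reach.2 (h.trans (mem_reach.1 hl))

theorem HasPath.reach_card_le {i j : ι} (h : HasPath A i j) :
    (reach A j).card ≤ (reach A i).card :=
  Finset.card_le_card h.reach_subset

/-- The number of reachable nodes is a strict rank on the reduced graph. -/
theorem HasPath.reach_card_lt {i j : ι} (h : HasPath A i j) (h' : ¬ HasPath A j i) :
    (reach A j).card < (reach A i).card :=
  Finset.card_lt_card ⟨h.reach_subset, fun hss => h' (mem_reach.1 (hss (mem_reach.2 (.refl i))))⟩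

theorem exists_final_node {p : ι → Prop} {i : ι} (hi : p i) :
    ∃ j, HasPath A i j ∧ p j ∧ ∀ l, p l → HasPath A j l → HasPath A l j := by
  classical
  obtain ⟨j, hj, hmin⟩ := Finset.exists_min_image
    (Finset.univ.filter fun j => HasPath A i j ∧ p j) (fun j => (reach A j).card) ⟨i,
      Finset.mem_filter.2 ⟨Finset.mem_univ i, .refl i, hi⟩⟩
  simp only [Finset.mem_filter, Finset.mem_univ, true_and] at hj hmin
  refine ⟨j, hj.1, hj.2, fun l hl hjl => ?_⟩
  by_contra h
  exact (hjl.reach_card_lt h).not_ge (hmin l ⟨hj.1.trans hjl, hl⟩)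

/-- Choose a class reachable from `i` that is final within the support of `x`. No arc leads from it
to the rest of the support, so `x` restricts to an eigenvector of its block. -/
theorem mem_spectralAccessSet_of_eigenvector (K : Alg) {ρ : ℝ≥0} (hρ : ρ ≠ 0) {x : ι → ℝ≥0}
    (hx : K.mulVec A x = ρ • x) {i : ι} (hi : x i ≠ 0) : i ∈ spectralAccessSet K A ρ := by
  obtain ⟨j, hij, hj, hfin⟩ := exists_final_node (A := A) (p := fun l => x l ≠ 0) hi
  set ν := MatrixClass.of A j
  have hjν : j ∈ ν.nodes := MatrixClass.mem_nodes_of A j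
  have hν : ν.perronRoot K = ρ := by
    refine ν.perronRoot_eq K hx hjν hj fun a ha l hl => ?_
    by_contra h0
    have hjl : HasPath A j l :=
      ((MatrixClass.mem_nodes_iff hjν a).1 ha).1.trans (.of_ne_zero (left_ne_zero_of_mul h0))
    exact hl ((MatrixClass.mem_nodes_iff hjν l).2 ⟨hjl, hfin l (right_ne_zero_of_mul h0) hjl⟩)
  refine ⟨ν, ⟨hρ, hν, ?_⟩, (MatrixClass.nodeAccesses_iff hjν).2 hij⟩
  cases K with
  | nonneg =>
    intro μ hμ hne
    obtain ⟨a, ha⟩ := μ.nodes_nonempty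
    have hjμ : j ∉ μ.nodes := fun h => hne (MatrixClass.eq_of_mem_of_mem h hjν)
    -- An arc leaving `μ` into the support makes the restriction of `x` to `μ` a strict
    -- sub-eigenvector at `b`.
    obtain ⟨b, hb, l, hl, hbl, hlj⟩ :=
      ((MatrixClass.accesses_iff ha hjν).1 hμ).exists_exit ha hjμ
    rw [hν]
    exact μ.perronRoot_lt hx.le hb hl hbl (Alg.nonneg.ne_zero_of_hasPath hx.le hlj hj)
  | max =>
    intro μ hμ
    obtain ⟨a, ha⟩ := μ.nodes_nonempty
    rw [hν]
    exact μ.perronRoot_le Alg.max hx.le ha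
      (Alg.max.ne_zero_of_hasPath hx.le ((MatrixClass.accesses_iff ha hjν).1 hμ) hj)

/-- The Knaster–Tarski argument for the monotone map $\rho^{-1}A$. -/
theorem exists_eigenvector_between (K : Alg) {ρ : ℝ≥0} (hρ : ρ ≠ 0) {u w : ι → ℝ≥0} (huw : u ≤ w)
    (hu : ρ • u ≤ K.mulVec A u) (hw : K.mulVec A w ≤ ρ • w) :
    ∃ x, u ≤ x ∧ K.mulVec A x = ρ • x := by
  have hρ0 := pos_iff_ne_zero.2 hρ
  let S : Set (ι → ℝ≥0) := {y | y ≤ w ∧ ρ • y ≤ K.mulVec A y}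
  have hS : BddAbove S := ⟨w, fun y hy => hy.1⟩
  have huS : u ∈ S := ⟨huw, hu⟩
  have hxw : sSup S ≤ w := csSup_le ⟨u, huS⟩ fun y hy => hy.1
  have h1 : ρ • sSup S ≤ K.mulVec A (sSup S) := by
    rw [← le_inv_smul_iff_of_pos hρ0]
    refine csSup_le ⟨u, huS⟩ fun y hy => ?_
    rw [le_inv_smul_iff_of_pos hρ0]
    exact hy.2.trans (K.mulVec_mono A (le_csSup hS hy))
  refine ⟨sSup S, le_csSup hS huS, le_antisymm ?_ h1⟩
  rw [← inv_smul_le_iff_of_pos hρ0]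
  refine le_csSup hS ⟨?_, ?_⟩
  · rw [inv_smul_le_iff_of_pos hρ0]
    exact (K.mulVec_mono A hxw).trans hw
  · rw [smul_inv_smul₀ hρ]
    refine K.mulVec_mono A ?_
    rwa [le_inv_smul_iff_of_pos hρ0]

theorem exists_one_le_forall_le_mul (f g : ι → ℝ≥0) (hg : ∀ i, g i ≠ 0) :
    ∃ t : ℝ≥0, 1 ≤ t ∧ ∀ i, f i ≤ t * g i := by
  refine ⟨1 + ∑ i, f i / g i, le_self_add, fun i => ?_⟩
  rw [← div_le_iff₀ (pos_iff_ne_zero.2 (hg i))]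
  exact (Finset.single_le_sum (f := fun i => f i / g i) (fun _ _ => zero_le)
    (Finset.mem_univ i)).trans le_add_self

/-- Glue the Perron vectors of the classes accessing `ν`, weighting each by a large `t` to the power
of its rank, so that whatever a class receives from later classes fits in its room `ε`. This is the
super-eigenvector `w`; its part `u` on `ν` is the sub-eigenvector. -/
theorem MatrixClass.IsSpectral.exists_eigenvector {K : Alg} {ν : MatrixClass A} {ρ : ℝ≥0}
    (hν : ν.IsSpectral K ρ) :
    ∃ x, K.mulVec A x = ρ • x ∧ ∀ i, NodeAccesses i ν → x i ≠ 0 := by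
  classical
  obtain ⟨j, hj⟩ := ν.nodes_nonempty
  obtain ⟨v, hv, hvr⟩ := exists_perronVectors K A
  have hε (i : ι) : ∃ ε, ε ≠ 0 ∧ (HasPath A i j → i ∉ ν.nodes →
      K.add ((of A i).perronRoot K) ε ≤ ρ) := by
    by_cases h : HasPath A i j ∧ i ∉ ν.nodes
    · obtain ⟨ε, h1, h2⟩ := hν.exists_add_le ((accesses_iff (mem_nodes_of A i) hj).2 h.1)
        fun h0 => h.2 (h0 ▸ mem_nodes_of A i)
      exact ⟨ε, h1, fun _ _ => h2⟩
    · exact ⟨1, one_ne_zero, fun h1 h2 => absurd ⟨h1, h2⟩ h⟩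
  choose ε hε0 hε using hε
  obtain ⟨t, ht1, ht⟩ := exists_one_le_forall_le_mul (K.mulVec A v) (fun i => ε i * v i)
    fun i => mul_ne_zero (hε0 i) (hv i)
  have ht0 : t ≠ 0 := (zero_lt_one.trans_le ht1).ne'
  set w : ι → ℝ≥0 := fun i => if HasPath A i j then t ^ (reach A i).card * v i else 0 with hw
  have hwpos {i : ι} (hi : HasPath A i j) : w i = t ^ (reach A i).card * v i := if_pos hi
  have hwneg {i : ι} (hi : ¬ HasPath A i j) : w i = 0 := if_neg hi
  have hclass {i : ι} (hi : HasPath A i j) :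
      (K.sum (of A i).nodes fun l => A i l * w l) = (of A i).perronRoot K * w i := by
    rw [hwpos hi, mul_left_comm, ← hvr, K.mul_sum]
    refine K.sum_congr fun l hl => ?_
    have hil := (mem_nodes_iff (mem_nodes_of A i) l).1 hl
    rw [hwpos (hil.2.trans hi), le_antisymm hil.1.reach_card_le hil.2.reach_card_le]
    ring
  set u : ι → ℝ≥0 := fun i => if i ∈ ν.nodes then w i else 0 with hu
  have hu_of {i : ι} (hi : i ∈ ν.nodes) : u i = w i := if_pos hi
  have hpath {i : ι} (hi : i ∈ ν.nodes) : HasPath A i j := ((mem_nodes_iff hj i).1 hi).2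
  have huw : u ≤ w := fun i => by
    by_cases hi : i ∈ ν.nodes
    · exact (hu_of hi).le
    · exact (if_neg hi).le.trans zero_le
  have hu1 : ρ • u ≤ K.mulVec A u := fun i => by
    by_cases hi : i ∈ ν.nodes
    · have h := hclass (hpath hi)
      rw [of_eq hi, hν.2.1, ← hu_of hi] at h
      rw [Pi.smul_apply, smul_eq_mul, ← h]
      refine le_trans (le_of_eq (K.sum_congr fun l hl => ?_))
        (K.sum_mono_set (Finset.subset_univ ν.nodes) _)
      rw [hu_of hl]
    · have h0 : u i = 0 := if_neg hi
      simp [h0]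
  have hw1 : K.mulVec A w ≤ ρ • w := fun i => by
    by_cases hi : HasPath A i j
    · rw [mulVec_eq_add K (of A i).nodes, hclass hi, Pi.smul_apply, smul_eq_mul]
      by_cases hiν : i ∈ ν.nodes
      · rw [of_eq hiν, hν.2.1, K.sum_eq_zero (s := ν.nodesᶜ), K.add_zero]
        intro l hl
        by_contra h0
        have hlj : HasPath A l j := by
          by_contra h1
          exact right_ne_zero_of_mul h0 (hwneg h1)
        exact Finset.mem_compl.1 hl ((mem_nodes_iff hiν l).2
          ⟨.of_ne_zero (left_ne_zero_of_mul h0), hlj.trans ((mem_nodes_iff hiν j).1 hj).2⟩)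
      -- Successors outside the class have smaller rank, which frees a factor `t` to absorb
      -- `K.mulVec A v`.
      · have hlow : (K.sum (of A i).nodesᶜ fun l => A i l * w l) ≤ ε i * w i := by
          calc (K.sum (of A i).nodesᶜ fun l => A i l * w l)
              ≤ K.sum (of A i).nodesᶜ fun l => t ^ ((reach A i).card - 1) * (A i l * v l) := by
                refine K.sum_mono fun l hl => ?_
                by_cases hil : A i l = 0
                · simp [hil]
                by_cases hlj : HasPath A l j
                · rw [hwpos hlj, mul_left_comm]
                  refine mul_le_mul_left (pow_le_pow_right₀ ht1 (Nat.le_sub_one_of_lt ?_)) _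
                  refine HasPath.reach_card_lt (.of_ne_zero hil) fun hli => ?_
                  exact Finset.mem_compl.1 hl
                    ((mem_nodes_iff (mem_nodes_of A i) l).2 ⟨.of_ne_zero hil, hli⟩)
                · simp [hwneg hlj]
            _ ≤ K.sum Finset.univ fun l => t ^ ((reach A i).card - 1) * (A i l * v l) :=
                K.sum_mono_set (Finset.subset_univ _) _
            _ = t ^ ((reach A i).card - 1) * K.mulVec A v i := (K.mul_sum _ _ _).symm
            _ ≤ t ^ ((reach A i).card - 1) * (t * (ε i * v i)) := mul_le_mul_right (ht i) _
            _ = ε i * w i := by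
                rw [hwpos hi, ← mul_assoc, pow_sub_one_mul (reach_card_pos A i).ne']
                ring
        refine (K.add_mono le_rfl hlow).trans ?_
        rw [← K.add_mul]
        exact mul_le_mul_left (hε i hi hiν) _
    · refine le_of_eq_of_le (K.sum_eq_zero fun l _ => ?_) zero_le
      by_contra h0
      refine right_ne_zero_of_mul h0 (hwneg fun hlj => hi ?_)
      exact .trans (.of_ne_zero (left_ne_zero_of_mul h0)) hlj
  obtain ⟨x, hux, hx⟩ := exists_eigenvector_between K hν.1 huw hu1 hw1
  refine ⟨x, hx, fun i hi => ?_⟩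
  refine K.ne_zero_of_hasPath hx.le ((nodeAccesses_iff hj).1 hi) fun h0 => ?_
  have h1 := hux j
  rw [h0, hu_of hj, hwpos (.refl j), nonpos_iff_eq_zero] at h1
  exact mul_ne_zero (pow_ne_zero _ ht0) (hv j) h1

/-- The nodes that access a spectral class form the union of the supports of the eigenvectors. -/
theorem mem_spectralAccessSet_iff (K : Alg) {ρ : ℝ≥0} (hρ : ρ ≠ 0) {i : ι} :
    i ∈ spectralAccessSet K A ρ ↔ ∃ x, K.mulVec A x = ρ • x ∧ x i ≠ 0 := by
  constructor
  · rintro ⟨ν, hν, hi⟩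
    obtain ⟨x, hx, h⟩ := hν.exists_eigenvector
    exact ⟨x, hx, h i hi⟩
  · rintro ⟨x, hx, hi⟩
    exact mem_spectralAccessSet_of_eigenvector K hρ hx hi

end Paths

/-! ### The reduced matrix -/

section Reduced

variable {ι : Type*} {K : Alg} {A : Matrix ι ι ℝ≥0} {ρ : ℝ≥0}

theorem mem_spectralAccessSet_of_ne_zero [Fintype ι] {i j : ι} (h : A i j ≠ 0)
    (hj : j ∈ spectralAccessSet K A ρ) : i ∈ spectralAccessSet K A ρ := by
  obtain ⟨ν, hν, hjν⟩ := hj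
  obtain ⟨l, hl⟩ := ν.nodes_nonempty
  refine ⟨ν, hν, (MatrixClass.nodeAccesses_iff hl).2 ?_⟩
  exact (HasPath.of_ne_zero h).trans ((MatrixClass.nodeAccesses_iff hl).1 hjν)

variable [Fintype ι]

/-- No condition on `i` is needed, because $M_\rho$ contains the predecessors of its nodes. -/
theorem reducedMatrix_apply {i j : ι} (hj : j ∈ spectralAccessSet K A ρ) :
    reducedMatrix K A ρ i j = ρ⁻¹ * A i j := by
  by_cases hi : i ∈ spectralAccessSet K A ρ
  · exact if_pos ⟨hi, hj⟩
  · have h0 : A i j = 0 := by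
      by_contra h
      exact hi (mem_spectralAccessSet_of_ne_zero h hj)
    rw [h0, mul_zero]
    exact if_neg fun h => hi h.1

theorem reducedMatrix_mulVec {x : ι → ℝ≥0} (hx : ∀ i, x i ≠ 0 → i ∈ spectralAccessSet K A ρ) :
    K.mulVec (reducedMatrix K A ρ) x = ρ⁻¹ • K.mulVec A x := by
  rw [← K.smul_mulVec]
  refine funext fun i => K.sum_congr fun j _ => ?_
  by_cases h : x j = 0
  · simp [h]
  · rw [reducedMatrix_apply (hx j h)]
    rfl

theorem mem_of_reducedMatrix_mulVec_ne_zero {x : ι → ℝ≥0} {i : ι}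
    (h : K.mulVec (reducedMatrix K A ρ) x i ≠ 0) : i ∈ spectralAccessSet K A ρ := by
  obtain ⟨j, -, hj⟩ := K.exists_ne_zero_of_sum_ne_zero h
  by_contra hi
  exact left_ne_zero_of_mul hj (if_neg fun h => hi h.1)

theorem mem_of_reducedMatrix_iterate_ne_zero {x : ι → ℝ≥0} {k : ℕ} (hk : 1 ≤ k) {i : ι}
    (h : (K.mulVec (reducedMatrix K A ρ))^[k] x i ≠ 0) : i ∈ spectralAccessSet K A ρ := by
  obtain ⟨k, rfl⟩ := Nat.exists_eq_add_of_le' hk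
  rw [Function.iterate_succ_apply'] at h
  exact mem_of_reducedMatrix_mulVec_ne_zero h

theorem Alg.iterate_smul_mulVec (K : Alg) (A : Matrix ι ι ℝ≥0) (c : ℝ≥0) (k : ℕ) (x : ι → ℝ≥0) :
    (K.mulVec (c • A))^[k] x = c ^ k • (K.mulVec A)^[k] x := by
  induction k with
  | zero => simp
  | succ k ih =>
    rw [Function.iterate_succ_apply', Function.iterate_succ_apply', ih, K.mulVec_smul,
      K.smul_mulVec, smul_smul, pow_succ]

theorem reducedMatrix_iterate {x : ι → ℝ≥0} (hx : ∀ i, x i ≠ 0 → i ∈ spectralAccessSet K A ρ)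
    (k : ℕ) : (K.mulVec (reducedMatrix K A ρ))^[k] x = ρ⁻¹ ^ k • (K.mulVec A)^[k] x := by
  rw [← K.iterate_smul_mulVec]
  induction k with
  | zero => rfl
  | succ k ih =>
    rw [Function.iterate_succ_apply', Function.iterate_succ_apply', ← ih, reducedMatrix_mulVec,
      K.smul_mulVec]
    intro i hi
    rcases k.eq_zero_or_pos with rfl | hk
    · exact hx i hi
    · exact mem_of_reducedMatrix_iterate_ne_zero hk hi

/-- Sum, over the nodes of $M_\rho$, an eigenvector that is nonzero at that node. -/
theorem exists_eigenvector_full_support (K : Alg) (A : Matrix ι ι ℝ≥0) (hρ : ρ ≠ 0) :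
    ∃ x, K.mulVec A x = ρ • x ∧ ∀ i, x i ≠ 0 ↔ i ∈ spectralAccessSet K A ρ := by
  have h (i : ι) : ∃ x, K.mulVec A x = ρ • x ∧ (i ∈ spectralAccessSet K A ρ → x i ≠ 0) := by
    by_cases hi : i ∈ spectralAccessSet K A ρ
    · obtain ⟨x, hx, hxi⟩ := (mem_spectralAccessSet_iff K hρ).1 hi
      exact ⟨x, hx, fun _ => hxi⟩
    · exact ⟨0, by rw [K.mulVec_zero, smul_zero], fun h => absurd h hi⟩
  choose x hx hxi using h
  have hy : (K.mulVec A fun i => K.sum Finset.univ fun a => x a i) =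
      ρ • fun i => K.sum Finset.univ fun a => x a i := by
    rw [K.mulVec_sum]
    ext i : 1
    rw [Pi.smul_apply, smul_eq_mul, K.mul_sum]
    exact K.sum_congr fun a _ => congrFun (hx a) i
  refine ⟨_, hy, fun i => ⟨fun hi => mem_spectralAccessSet_of_eigenvector K hρ hy hi, fun hi => ?_⟩⟩
  exact ((pos_iff_ne_zero.2 (hxi i hi)).trans_le
    (K.le_sum (fun a => x a i) (Finset.mem_univ i))).ne'

/-! ### Matrix powers -/

variable [DecidableEq ι]

/-- The orbit of `x` under $\rho^{-1}A$ closes up after `k` steps, so $\rho^{-1}A$ permutes the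
terms of its sum `y` cyclically. -/
theorem Alg.exists_eigenvector_of_pow (hρ : ρ ≠ 0) {k : ℕ} (hk : 1 ≤ k) {x : ι → ℝ≥0}
    (hx : K.mulVec (K.pow A k) x = ρ ^ k • x) : ∃ y, K.mulVec A y = ρ • y ∧ x ≤ y := by
  set u : ℕ → ι → ℝ≥0 := fun a => (K.mulVec (ρ⁻¹ • A))^[a] x with hu
  have huk : u k = x := by
    rw [hu]
    simp only
    rw [K.iterate_smul_mulVec, ← K.mulVec_pow, hx, smul_smul, ← mul_pow, inv_mul_cancel₀ hρ,
      one_pow, one_smul]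
  set y : ι → ℝ≥0 := fun i => K.sum (Finset.range k) fun a => u a i with hy
  have hxy : x ≤ y := fun i => K.le_sum (fun a => u a i) (Finset.mem_range.2 hk)
  have hfy : K.mulVec (ρ⁻¹ • A) y = fun i => K.sum (Finset.range k) fun a => u (a + 1) i := by
    rw [hy, K.mulVec_sum]
    refine funext fun i => K.sum_congr fun a _ => ?_
    simp only [hu, Function.iterate_succ_apply']
  have hshift (i : ι) : K.add (x i) (K.mulVec (ρ⁻¹ • A) y i) = K.add (x i) (y i) := by
    have h := K.sum_range_shift k fun a => u a i
    rw [huk] at h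
    rw [hfy]
    exact h
  -- The term `a = k - 1` of the shifted sum is `x`; the bound is needed to cancel `x` in max
  -- algebra.
  have hxfy (i : ι) : x i ≤ K.mulVec (ρ⁻¹ • A) y i := by
    have h := K.le_sum (fun a => u (a + 1) i) (Finset.mem_range.2 (Nat.sub_one_lt_of_lt hk))
    rw [Nat.sub_add_cancel hk, huk] at h
    rwa [hfy]
  have hfix : K.mulVec (ρ⁻¹ • A) y = y := funext fun i =>
    le_antisymm (K.le_of_add_le_add (hshift i).le (hxy i))
      (K.le_of_add_le_add (hshift i).ge (hxfy i))
  exact ⟨y, by rwa [K.smul_mulVec, inv_smul_eq_iff₀ hρ] at hfix, hxy⟩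

theorem Alg.mulVec_pow_of_eigenvector {x : ι → ℝ≥0} (hx : K.mulVec A x = ρ • x) (k : ℕ) :
    K.mulVec (K.pow A k) x = ρ ^ k • x := by
  rw [K.mulVec_pow]
  induction k with
  | zero => simp
  | succ k ih => rw [Function.iterate_succ_apply', ih, K.mulVec_smul, hx, smul_smul, pow_succ]

theorem spectralAccessSet_pow (K : Alg) (A : Matrix ι ι ℝ≥0) (hρ : ρ ≠ 0) {k : ℕ} (hk : 1 ≤ k) :
    spectralAccessSet K (K.pow A k) (ρ ^ k) = spectralAccessSet K A ρ := by
  ext i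
  rw [mem_spectralAccessSet_iff K (pow_ne_zero k hρ), mem_spectralAccessSet_iff K hρ]
  constructor
  · rintro ⟨x, hx, hi⟩
    obtain ⟨y, hy, hxy⟩ := Alg.exists_eigenvector_of_pow hρ hk hx
    exact ⟨y, hy, ((pos_iff_ne_zero.2 hi).trans_le (hxy i)).ne'⟩
  · rintro ⟨x, hx, hi⟩
    exact ⟨x, Alg.mulVec_pow_of_eigenvector hx k, hi⟩

theorem principalSubmatrix_pow (K : Alg) (A : Matrix ι ι ℝ≥0) (hρ : ρ ≠ 0) (k : ℕ) :
    principalSubmatrix (K.pow A k) (spectralAccessSet K A ρ) =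
      ρ ^ k • principalSubmatrix (K.pow (reducedMatrix K A ρ) k) (spectralAccessSet K A ρ) := by
  refine Matrix.ext fun ⟨i, hi⟩ ⟨j, hj⟩ => ?_
  change K.pow A k i j = ρ ^ k * K.pow (reducedMatrix K A ρ) k i j
  induction k generalizing j with
  | zero => simp [Alg.pow]
  | succ k ih =>
    change (K.sum _ fun l => K.pow A k i l * A l j) =
      ρ ^ (k + 1) * K.sum _ fun l => K.pow (reducedMatrix K A ρ) k i l * reducedMatrix K A ρ l j
    rw [K.mul_sum]
    refine K.sum_congr fun l _ => ?_
    rw [reducedMatrix_apply hj]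
    by_cases h : A l j = 0
    · simp [h]
    · rw [ih l (mem_spectralAccessSet_of_ne_zero h hj)]
      calc ρ ^ k * K.pow (reducedMatrix K A ρ) k i l * A l j
          = ρ ^ k * K.pow (reducedMatrix K A ρ) k i l * (ρ * ρ⁻¹ * A l j) := by
            rw [mul_inv_cancel₀ hρ, one_mul]
        _ = _ := by ring

theorem eigencone_pow (K : Alg) (A : Matrix ι ι ℝ≥0) (hρ : ρ ≠ 0) {k : ℕ} (hk : 1 ≤ k) :
    K.eigencone (K.pow A k) (ρ ^ k) = K.eigencone (K.pow (reducedMatrix K A ρ) k) 1 := by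
  have key {x : ι → ℝ≥0} (hx : ∀ i, x i ≠ 0 → i ∈ spectralAccessSet K A ρ) :
      x ∈ K.eigencone (K.pow A k) (ρ ^ k) ↔ x ∈ K.eigencone (K.pow (reducedMatrix K A ρ) k) 1 := by
    simp only [Alg.eigencone, Set.mem_ofPred_eq, K.mulVec_pow, one_smul]
    rw [reducedMatrix_iterate hx, inv_pow, inv_smul_eq_iff₀ (pow_ne_zero k hρ)]
  ext x
  constructor <;> intro h
  · refine (key fun i hi => ?_).1 h
    rw [← spectralAccessSet_pow K A hρ hk]
    exact mem_spectralAccessSet_of_eigenvector K (pow_ne_zero k hρ) h hi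
  · refine (key fun i hi => ?_).2 h
    have h1 : (K.mulVec (reducedMatrix K A ρ))^[k] x = x := by
      rw [← K.mulVec_pow]
      exact Eq.trans h (one_smul ℝ≥0 x)
    exact mem_of_reducedMatrix_iterate_ne_zero hk (by rwa [h1])

theorem isGreatest_eigenvalue_reducedMatrix_pow (hρ : ρ ∈ K.nonzeroSpectrum A) {k : ℕ}
    (hk : 1 ≤ k) : IsGreatest {r | K.IsEigenvalue (K.pow (reducedMatrix K A ρ) k) r} 1 := by
  obtain ⟨hρ0, x, hx0, hx⟩ := hρ
  constructor
  · refine ⟨x, hx0, ?_⟩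
    have h : x ∈ K.eigencone (K.pow A k) (ρ ^ k) := Alg.mulVec_pow_of_eigenvector hx k
    rwa [eigencone_pow K A hρ0 hk] at h
  · rintro r ⟨z, hz, hzr⟩
    obtain ⟨y, hy, hyM⟩ := exists_eigenvector_full_support K A hρ0
    have h : y ∈ K.eigencone (K.pow A k) (ρ ^ k) := Alg.mulVec_pow_of_eigenvector hy k
    rw [eigencone_pow K A hρ0 hk] at h
    -- For `r ≠ 0` the eigenvector `z` is a multiple of its own image, hence supported in $M_\rho$;
    -- for `r = 0` it need not be.
    by_cases hr : r = 0
    · exact hr.le.trans zero_le_one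
    refine K.eigenvalue_le hz hzr (le_of_eq h) fun i hi => (hyM i).2 ?_
    refine mem_of_reducedMatrix_iterate_ne_zero (x := z) hk ?_
    rw [← K.mulVec_pow, hzr]
    exact mul_ne_zero hr hi

end Reduced

theorem theorem4p7 (K : Alg) (n : ℕ) (A : Matrix (Fin n) (Fin n) ℝ≥0) (ρ : ℝ≥0)
    (hρ : ρ ∈ K.nonzeroSpectrum A) (k : ℕ) (hk : 1 ≤ k) :
    spectralAccessSet K (K.pow A k) (ρ ^ k) = spectralAccessSet K A ρ ∧
    principalSubmatrix (K.pow A k) (spectralAccessSet K A ρ) =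
      ρ ^ k • principalSubmatrix (K.pow (reducedMatrix K A ρ) k) (spectralAccessSet K A ρ) ∧
    K.eigencone (K.pow A k) (ρ ^ k) = K.eigencone (K.pow (reducedMatrix K A ρ) k) 1 ∧
    IsGreatest {r | K.IsEigenvalue (K.pow (reducedMatrix K A ρ) k) r} 1 :=
  ⟨spectralAccessSet_pow K A hρ.1 hk, principalSubmatrix_pow K A hρ.1 k,
    eigencone_pow K A hρ.1 hk, isGreatest_eigenvalue_reducedMatrix_pow hρ hk⟩

end
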